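/- Let $T$ be the vertex set of a rooted tree with root $x_0$, in which every level $T_n$ (the set of vertices at distance $n$ from $x_0$) is finite and every vertex $x$ has at least two children; write $S(x)$ for the set of children of $x$. For $x\in T$ and $y\in S(x)$ let $q(x,y)>0$ be real numbers with $\sum_{y\in S(x)}q(x,y)=1$ for every $x\in T$. Let $\partial T$ be the set of all infinite geodesics $e$ starting at $x_0$, let $B_x=\{e\in\partial T: x\in e\}$ for $x\in T$, and let $\mathbb P$ be the probability measure on (the completion of) the $\sigma$-algebra generated by the sets $B_x$ for which $\mathbb P(B_x)=\prod_{j=0}^{n-1}q(y_j,y_{j+1})$ whenever $x_0=y_0,y_1,\dots,y_n=x$ is the geodesic from $x_0$ to $x$. Let $E$ be a separable normed space over $\mathbb C$. Let $L^0(\partial T,E)$ be the space of measurable functions $\partial T\to E$ modulo $\mathbb P$-almost everywhere equality, with the metric $P(\psi,\varphi)=\int_{\partial T}\frac{\|\psi-\varphi\|}{1+\|\psi-\varphi\|}\,d\mathbb P$ (convergence in probability). For $x\in T$ and $y\in S(x)$ let $w(x,y)\in\mathbb C\setminus\{0\}$ be such that $\sum_{y\in S(x)}w(x,y)=1$ for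 every $x\in T$. Let $H(T,E)$ be the vector space of all (generalized harmonic) functions $f:T\to E$ with $f(x)=\sum_{y\in S(x)}w(x,y)f(y)$ for all $x\in T$, with the topology of pointwise convergence. For $f\in H(T,E)$ and $n\ge 1$ let $\omega_n(f):\partial T\to E$ be the function $\omega_n(f)(e)=f(z)$, where $z$ is the unique element of $e\cap T_n$. Call $f\in H(T,E)$ universal if the sequence $(\omega_n(f))_{n\ge1}$ is dense in $L^0(\partial T,E)$, and let $U(T,E)$ be the set of universal functions. Then there exist two vector subspaces $F_1,F_2$ of $H(T,E)$, both contained in $U(T,E)\cup\{0\}$ and both dense in $H(T,E)$, such that $F_1\cap F_2=\{0\}$. (The case $E=\mathbb C$, $w=q$ concerns the ordinary harmonic functions.) -/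

import Mathlib

open MeasureTheory

/-- A rooted tree with vertex set `V`: a tree (connected acyclic graph) with a distinguished root,
finitely many vertices at each distance from the root, and at least two children at each vertex. -/
structure BranchingTree (V : Type*) where
  graph : SimpleGraph V
  isTree : graph.IsTree
  root : V
  finite_level : ∀ n : ℕ, {x | graph.dist root x = n}.Finite
  nontrivial_children :
    ∀ x, {y | graph.Adj x y ∧ graph.dist root y = graph.dist root x + 1}.Nontrivial

namespace BranchingTree

variable {V : Type*} (T : BranchingTree V)

/-- The level `T_n`: the (finite) set of vertices at distance `n` from the root. -/
noncomputable def level (n : ℕ) : Finset V := (T.finite_level n).toFinset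

/-- The set `S(x)` of children of `x`: the neighbours of `x` that are one step further away from
the root. It is a finite set. -/
noncomputable def children (x : V) : Finset V :=
  (show {y | T.graph.Adj x y ∧ T.graph.dist T.root y = T.graph.dist T.root x + 1}.Finite from
    (T.finite_level (T.graph.dist T.root x + 1)).subset fun _ hy => hy.2).toFinset

theorem mem_level {n : ℕ} {x : V} : x ∈ T.level n ↔ T.graph.dist T.root x = n := by
  simp [level]

theorem mem_children {x y : V} :
    y ∈ T.children x ↔ T.graph.Adj x y ∧ T.graph.dist T.root y = T.graph.dist T.root x + 1 := by
  simp [children]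

/-- The boundary `∂T`: infinite geodesics from the root, i.e. sequences `z` of vertices
with `z 0` the root and `z (n + 1)` a child of `z n`. -/
structure Boundary where
  vertex : ℕ → V
  vertex_zero : vertex 0 = T.root
  vertex_succ : ∀ n, vertex (n + 1) ∈ T.children (vertex n)

/-- The boundary sector `B_x` of a vertex `x`: the geodesics passing through `x`. -/
def sector (x : V) : Set T.Boundary := {e | ∃ n, e.vertex n = x}

/-- The σ-algebra on `∂T` generated by all boundary sectors. -/
instance : MeasurableSpace T.Boundary := MeasurableSpace.generateFrom (Set.range T.sector)

theorem dist_boundary (e : T.Boundary) (n : ℕ) : T.graph.dist T.root (e.vertex n) = n := by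
  induction n with
  | zero => simp [e.vertex_zero]
  | succ n ih => rw [(T.mem_children.1 (e.vertex_succ n)).2, ih]

theorem mem_sector_iff (e : T.Boundary) (x : V) :
    e ∈ T.sector x ↔ e.vertex (T.graph.dist T.root x) = x := by
  constructor
  · rintro ⟨n, rfl⟩
    rw [dist_boundary]
  · exact fun h => ⟨_, h⟩

theorem measurableSet_sector (x : V) : MeasurableSet (T.sector x) :=
  MeasurableSpace.measurableSet_generateFrom ⟨x, rfl⟩

/-- A vertex has only one parent. -/
theorem parent_unique {x x' y : V} (h : y ∈ T.children x) (h' : y ∈ T.children x') : x = x' := by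
  rw [mem_children] at h h'
  have key : ∀ z, T.graph.Adj z y → T.graph.dist T.root y = T.graph.dist T.root z + 1 →
      ∃ p : T.graph.Walk T.root y, p.IsPath ∧ p.penultimate = z := by
    intro z hz hd
    obtain ⟨p, hp⟩ := (T.isTree.connected T.root z).exists_walk_length_eq_dist
    refine ⟨p.concat hz, (p.concat hz).isPath_of_length_eq_dist ?_, by simp⟩
    rw [SimpleGraph.Walk.length_concat, hp, hd]
  obtain ⟨p, hp, rfl⟩ := key x h.1 h.2
  obtain ⟨p', hp', rfl⟩ := key x' h'.1 h'.2
  rw [(T.isTree.existsUnique_path T.root y).unique hp hp']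

/-- Transition probabilities `q x y > 0` from each vertex `x` to its children `y`, summing to `1`
over the children. (Values `q x y` where `y` is not a child of `x` play no role.) -/
structure TransitionProb where
  q : V → V → ℝ
  pos : ∀ x, ∀ y ∈ T.children x, 0 < q x y
  sum_eq_one : ∀ x, ∑ y ∈ T.children x, q x y = 1

/-- The children of `x` as a type, with its discrete σ-algebra. -/
structure Child (x : V) where
  vertex : V
  mem : vertex ∈ T.children x

/-- The type of children of `x` is the finite set of children. -/
def childEquiv (x : V) : {y : V // y ∈ T.children x} ≃ T.Child x where
  toFun y := ⟨y.1, y.2⟩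
  invFun y := ⟨y.vertex, y.mem⟩

noncomputable instance (x : V) : Fintype (T.Child x) := Fintype.ofEquiv _ (T.childEquiv x)

instance (x : V) : MeasurableSpace (T.Child x) := ⊤

instance (x : V) : DiscreteMeasurableSpace (T.Child x) := ⟨fun _ => trivial⟩

/-- The geodesic obtained from a choice of a child at every vertex, by following the choices from
the root: its `n`-th vertex. -/
def follow (c : ∀ x, T.Child x) : ℕ → V
  | 0 => T.root
  | n + 1 => (c (follow c n)).vertex

/-- The geodesic obtained by following, from the root, a choice of a child at every vertex. -/
def followBoundary (c : ∀ x, T.Child x) : T.Boundary :=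
  ⟨T.follow c, rfl, fun n => (c (T.follow c n)).mem⟩

namespace TransitionProb

variable {T} (Q : T.TransitionProb)

/-- The probability measure on the children of `x` that gives mass `q x y` to the child `y`. -/
noncomputable def stepMeasure (x : V) : Measure (T.Child x) :=
  (PMF.ofFintype (fun y : T.Child x => ENNReal.ofReal (Q.q x y.vertex)) (by
    rw [← ENNReal.ofReal_sum_of_nonneg fun y _ => (Q.pos x y.vertex y.mem).le]
    have h : ∑ y : T.Child x, Q.q x y.vertex = 1 := by
      rw [← Q.sum_eq_one x]
      rw [← Finset.sum_coe_sort (T.children x) (fun y => Q.q x y)]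
      exact (Equiv.sum_comp (T.childEquiv x) fun y => Q.q x y.vertex).symm
    rw [h, ENNReal.ofReal_one])).toMeasure

instance (x : V) : IsProbabilityMeasure (Q.stepMeasure x) := by
  unfold stepMeasure
  infer_instance

/-- The probability measure `ℙ` on the boundary: the law of the geodesic that starts at the root
and moves from each vertex `x` to a child of `x` chosen, independently for different vertices, with
the probabilities `q x ·`. By `prob_sector` below it is the measure with
`ℙ(B_x) = ∏ j < n, q(y_j, y_{j+1})`, where `y_0, …, y_n` is the geodesic from the root to `x`. -/
noncomputable def prob : Measure T.Boundary :=
  (Measure.infinitePi Q.stepMeasure).map T.followBoundary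

end TransitionProb

theorem measurable_followBoundary : Measurable T.followBoundary := by
  have key : ∀ (n : ℕ) (x : V), MeasurableSet {c : ∀ x, T.Child x | T.follow c n = x} := by
    intro n
    induction n with
    | zero => intro x; exact MeasurableSet.const (T.root = x)
    | succ n ih =>
      intro x
      have : {c : ∀ x, T.Child x | T.follow c (n + 1) = x} =
          ⋃ y ∈ (T.level n : Set V), {c | T.follow c n = y} ∩ {c | (c y).vertex = x} := by
        ext c
        simp only [Set.mem_ofPred_eq, Set.mem_iUnion, Set.mem_inter_iff, exists_prop,
          Finset.mem_coe, mem_level]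
        constructor
        · intro h
          exact ⟨T.follow c n, T.dist_boundary (T.followBoundary c) n, rfl, h⟩
        · rintro ⟨y, -, rfl, h⟩
          exact h
      rw [this]
      refine Set.Finite.measurableSet_biUnion (Finset.finite_toSet _) fun y _ => (ih y).inter ?_
      exact measurable_pi_apply y (MeasurableSet.of_discrete (s := {d : T.Child y | d.vertex = x}))
  refine measurable_generateFrom ?_
  rintro _ ⟨x, rfl⟩
  have : T.followBoundary ⁻¹' T.sector x =
      {c | T.follow c (T.graph.dist T.root x) = x} := by
    ext c
    exact T.mem_sector_iff _ _
  rw [this]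
  exact key _ _

instance (Q : T.TransitionProb) : IsProbabilityMeasure Q.prob :=
  Measure.isProbabilityMeasure_map T.measurable_followBoundary.aemeasurable

/-- The measure of a sector is the product of the transition probabilities along the geodesic from
the root. -/
theorem prob_sector (Q : T.TransitionProb) (e : T.Boundary) (n : ℕ) :
    Q.prob (T.sector (e.vertex n)) =
      ENNReal.ofReal (∏ j ∈ Finset.range n, Q.q (e.vertex j) (e.vertex (j + 1))) := by
  classical
  have hinj : Function.Injective e.vertex := fun a b h => by
    rw [← T.dist_boundary e a, h, T.dist_boundary]
  have hpath : ∀ (c : ∀ x, T.Child x) (n : ℕ),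
      T.follow c n = e.vertex n ↔ ∀ j < n, (c (e.vertex j)).vertex = e.vertex (j + 1) := by
    intro c n
    induction n with
    | zero => simp [follow, e.vertex_zero]
    | succ n ih =>
      constructor
      · intro h
        have h1 : T.follow c n = e.vertex n := T.parent_unique
          ((T.followBoundary c).vertex_succ n) (show T.follow c (n + 1) ∈ _ from h ▸ e.vertex_succ n)
        intro j hj
        rcases Nat.lt_succ_iff_lt_or_eq.1 hj with hj | rfl
        · exact ih.1 h1 j hj
        · rw [← h1]; exact h
      · intro h
        have h1 := ih.2 fun j hj => h j (hj.trans n.lt_succ_self)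
        change (c (T.follow c n)).vertex = _
        rw [h1]
        exact h n n.lt_succ_self
  have hset : T.followBoundary ⁻¹' T.sector (e.vertex n) =
      Set.pi ((Finset.range n).image e.vertex)
        (fun x => {d : T.Child x | ∀ j, e.vertex j = x → d.vertex = e.vertex (j + 1)}) := by
    ext c
    rw [Set.mem_preimage, mem_sector_iff, dist_boundary]
    change T.follow c n = e.vertex n ↔ _
    rw [hpath]
    simp only [Set.mem_pi, Finset.coe_image, Set.mem_image, Finset.coe_range, Set.mem_Iio,
      Set.mem_ofPred_eq]
    constructor
    · rintro h _ ⟨j, hj, rfl⟩ i hi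
      rw [hinj hi]
      exact h j hj
    · intro h j hj
      exact h _ ⟨j, hj, rfl⟩ j rfl
  rw [TransitionProb.prob, Measure.map_apply T.measurable_followBoundary
    (T.measurableSet_sector _), hset, Measure.infinitePi_pi _ (fun _ _ => MeasurableSet.of_discrete),
    Finset.prod_image fun a _ b _ h => hinj h,
    ENNReal.ofReal_prod_of_nonneg fun j _ => (Q.pos _ _ (e.vertex_succ j)).le]
  refine Finset.prod_congr rfl fun j _ => ?_
  have : {d : T.Child (e.vertex j) | ∀ i, e.vertex i = e.vertex j → d.vertex = e.vertex (i + 1)} =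
      {⟨e.vertex (j + 1), e.vertex_succ j⟩} := by
    ext d
    simp only [Set.mem_ofPred_eq, Set.mem_singleton_iff]
    constructor
    · intro h
      cases d
      congr 1
      exact h j rfl
    · rintro rfl i hi
      rw [hinj hi]
  rw [this, TransitionProb.stepMeasure, PMF.toMeasure_apply_singleton _ _ MeasurableSet.of_discrete]
  rfl

/-- The set `H(T, E)` of (generalized) harmonic functions with weights `w`, as a subspace of `E ^ T`:
functions with `f x = ∑ y ∈ S(x), w x y • f y`. As a subspace of the product space `V → E`
it carries the topology of pointwise convergence. -/
def harmonic (w : V → V → ℂ) (E : Type*) [NormedAddCommGroup E] [NormedSpace ℂ E] :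
    Submodule ℂ (V → E) where
  carrier := {f | ∀ x, f x = ∑ y ∈ T.children x, w x y • f y}
  add_mem' := by
    intro f g hf hg x
    simp only [Pi.add_apply, smul_add, Finset.sum_add_distrib]
    rw [← hf x, ← hg x]
  zero_mem' := by
    intro x
    simp
  smul_mem' := by
    intro a f hf x
    simp only [Pi.smul_apply]
    rw [hf x, Finset.smul_sum]
    exact Finset.sum_congr rfl fun y _ => smul_comm _ _ _

end BranchingTree

/-- `L⁰(Ω, E)`: almost everywhere equality classes of measurable functions. For separable `E` these
are the same classes as those of functions that are measurable for the completed σ-algebra. -/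
def L0 {Ω : Type*} [MeasurableSpace Ω] (μ : Measure Ω) (E : Type*) [NormedAddCommGroup E] : Type _ :=
  Ω →ₘ[μ] E

namespace L0

variable {Ω : Type*} [MeasurableSpace Ω] {μ : Measure Ω} {E : Type*} [NormedAddCommGroup E]

noncomputable instance : CoeFun (L0 μ E) fun _ => Ω → E := ⟨fun ψ => AEEqFun.cast ψ⟩

theorem integrable_dist_div [IsFiniteMeasure μ] (ψ φ : L0 μ E) :
    Integrable (fun e => dist (ψ e) (φ e) / (1 + dist (ψ e) (φ e))) μ := by
  have hm : AEStronglyMeasurable (fun e => dist (ψ e) (φ e)) μ :=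
    (AEEqFun.aestronglyMeasurable ψ).dist (AEEqFun.aestronglyMeasurable φ)
  refine Integrable.of_bound (C := 1) ?_ (Filter.Eventually.of_forall fun e => ?_)
  · exact (hm.aemeasurable.div (hm.aemeasurable.const_add 1)).aestronglyMeasurable
  · have := dist_nonneg (x := ψ e) (y := φ e)
    rw [Real.norm_of_nonneg (by positivity), div_le_one (by positivity)]
    linarith

/-- The metric `P(ψ, φ) = ∫ d(ψ, φ) / (1 + d(ψ, φ))` on `L⁰`, whose topology is that of convergence
in probability. -/
noncomputable instance [IsFiniteMeasure μ] : MetricSpace (L0 μ E) where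
  dist ψ φ := ∫ e, dist (ψ e) (φ e) / (1 + dist (ψ e) (φ e)) ∂μ
  dist_self ψ := by simp
  dist_comm ψ φ := by simp only [dist_comm]
  dist_triangle ψ φ χ := by
    rw [← integral_add (integrable_dist_div ψ φ) (integrable_dist_div φ χ)]
    refine integral_mono (integrable_dist_div ψ χ)
      ((integrable_dist_div ψ φ).add (integrable_dist_div φ χ)) fun e => ?_
    have h := dist_triangle (ψ e) (φ e) (χ e)
    have h1 := dist_nonneg (x := ψ e) (y := φ e)
    have h2 := dist_nonneg (x := φ e) (y := χ e)
    have h3 := dist_nonneg (x := ψ e) (y := χ e)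
    simp only
    generalize dist (ψ e) (φ e) = a at *
    generalize dist (φ e) (χ e) = b at *
    generalize dist (ψ e) (χ e) = c at *
    calc c / (1 + c) ≤ (a + b) / (1 + (a + b)) := by
          rw [div_le_div_iff₀ (by positivity) (by positivity)]
          nlinarith
      _ = a / (1 + (a + b)) + b / (1 + (a + b)) := add_div _ _ _
      _ ≤ a / (1 + a) + b / (1 + b) := by gcongr <;> linarith
  eq_of_dist_eq_zero := by
    intro ψ φ h
    have h0 := (integral_eq_zero_iff_of_nonneg
      (fun e => by positivity) (integrable_dist_div ψ φ)).1 h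
    refine AEEqFun.ext ?_
    filter_upwards [h0] with e he
    have h3 := dist_nonneg (x := ψ e) (y := φ e)
    rcases div_eq_zero_iff.1 he with h | h
    · exact dist_eq_zero.1 h
    · linarith

end L0

namespace BranchingTree

variable {V : Type*} (T : BranchingTree V)

/-- For `f : T → E`, the function `e ↦ f z` on `∂T`, with `z` the vertex of `e` at level `n`,
is measurable: it takes finitely many values and is constant on the sectors of level `n`. -/
theorem stronglyMeasurable_eval {E : Type*} [NormedAddCommGroup E] (f : V → E) (n : ℕ) :
    StronglyMeasurable fun e : T.Boundary => f (e.vertex n) := by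
  refine SimpleFunc.stronglyMeasurable
    ⟨fun e : T.Boundary => f (e.vertex n), fun a => ?_, ?_⟩
  · have : (fun e : T.Boundary => f (e.vertex n)) ⁻¹' {a} =
        ⋃ x ∈ {x | x ∈ T.level n ∧ f x = a}, T.sector x := by
      ext e
      simp only [Set.mem_preimage, Set.mem_singleton_iff, Set.mem_iUnion, Set.mem_ofPred_eq,
        exists_prop]
      constructor
      · intro h
        exact ⟨e.vertex n, ⟨T.mem_level.2 (T.dist_boundary e n), h⟩, n, rfl⟩
      · rintro ⟨x, ⟨hx, rfl⟩, h⟩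
        rw [mem_sector_iff, T.mem_level.1 hx] at h
        rw [h]
    rw [this]
    exact Set.Finite.measurableSet_biUnion ((T.level n).finite_toSet.subset fun x hx => hx.1)
      fun x _ => T.measurableSet_sector x
  · refine ((T.level n).finite_toSet.image f).subset ?_
    rintro _ ⟨e, rfl⟩
    exact ⟨e.vertex n, T.mem_level.2 (T.dist_boundary e n), rfl⟩

/-- `ω_n(f) ∈ L⁰(∂T, E)`: the class of `e ↦ f z`, where `z` is the vertex of `e` at level `n`. -/
noncomputable def omega (Q : T.TransitionProb) {E : Type*} [NormedAddCommGroup E]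
    (n : ℕ) (f : V → E) : L0 Q.prob E :=
  AEEqFun.mk (fun e : T.Boundary => f (e.vertex n)) (T.stronglyMeasurable_eval f n).aestronglyMeasurable

/-- The set `U(T, E)` of universal harmonic functions: those `f` for which the sequence
`ω_1(f), ω_2(f), …` is dense in `L⁰(∂T, E)`. -/
def universal (Q : T.TransitionProb) (w : V → V → ℂ) (E : Type*) [NormedAddCommGroup E]
    [NormedSpace ℂ E] : Set (T.harmonic w E) :=
  {f | Dense {ψ : L0 Q.prob E | ∃ n : ℕ, 1 ≤ n ∧ ψ = T.omega Q n f.1}}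

end BranchingTree

/-!
The two subspaces are the spans of the two halves of one countable family of harmonic functions, all
of whose nontrivial linear combinations are universal (`BranchingTree.exists_family_universal`).
As `0` is not universal unless `E = 0`, such a family is linearly independent, so that the two spans
meet only in `0`. Both halves are dense in `H(T, E)` because each function of a countable dense set
occurs in them, for every `n`, in a version that is changed only above level `n`. The family is
constructed explicitly, without Baire category, so `E` need not be complete.

The construction rests on *steering* (`BranchingTree.steered`). Every vertex `x` has a *minor* child,
chosen with probability at most `1/2`. Given `f x` and a target value `a`, give the value `a` to all
children of `x` but the minor one, and to the minor child `y` the value `a + (f x - a) / w x y`, which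
makes `f` harmonic at `x` since the weights sum to `1`. If this is repeated with a target that is
constant along geodesics, then from each level to the next the probability that `f` misses the target
is halved: once `f` has the target value it keeps it, and otherwise the target is missed again only
at the minor child (`BranchingTree.prob_steered_ne_le`).

The levels are divided into blocks, block `s` leading from level `s ^ 2` to level `(s + 1) ^ 2`.
In each block one function of the family is steered towards a function from a countable set that is
dense in `L⁰` and consists of functions of the vertex at a single level
(`BranchingTree.exists_dist_omega_lt`), and all others are steered towards `0`; each pair of a family
member and a target occurs in infinitely many blocks. At the end of the block a linear combination
with coefficients `c` is, up to small probability, `c j` times the target, where `j` is the index of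
the steered function. If `c j ≠ 0`, these functions are dense in `L⁰`
(`BranchingTree.linearCombination_mem_universal`).
-/

/-! ### Distances in `L⁰` -/

namespace L0

variable {Ω : Type*} [MeasurableSpace Ω] {μ : Measure Ω} {E : Type*} [NormedAddCommGroup E]

/-- The class in `L⁰` of a strongly measurable function. -/
noncomputable def mk (μ : Measure Ω) (f : Ω → E) (hf : StronglyMeasurable f) : L0 μ E :=
  AEEqFun.mk f hf.aestronglyMeasurable

theorem coeFn_mk (f : Ω → E) (hf : StronglyMeasurable f) : ∀ᵐ e ∂μ, mk μ f hf e = f e :=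
  AEEqFun.coeFn_mk f hf.aestronglyMeasurable

/-- Two functions that are `δ`-close outside a set of small measure are close in `L⁰`. -/
theorem dist_mk_le [IsProbabilityMeasure μ] {f g : Ω → E} (hf : StronglyMeasurable f)
    (hg : StronglyMeasurable g) {δ : ℝ} (hδ : 0 ≤ δ) :
    dist (mk μ f hf) (mk μ g hg) ≤ δ + μ.real {e | δ < dist (f e) (g e)} := by
  have hm : MeasurableSet {e | δ < dist (f e) (g e)} :=
    measurableSet_lt measurable_const (hf.dist hg).measurable
  have hint : Integrable ({e | δ < dist (f e) (g e)}.indicator (fun _ => (1 : ℝ))) μ :=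
    (integrable_const 1).indicator hm
  have hrhs : δ + μ.real {e | δ < dist (f e) (g e)} =
      ∫ e, (δ + {e | δ < dist (f e) (g e)}.indicator (fun _ => (1 : ℝ)) e) ∂μ := by
    rw [integral_add (integrable_const _) hint, integral_indicator_const _ hm]
    simp
  rw [hrhs]
  refine integral_mono_ae (integrable_dist_div _ _) ((integrable_const _).add hint) ?_
  filter_upwards [coeFn_mk f hf, coeFn_mk g hg] with e hfe hge
  rw [hfe, hge]
  have h0 := dist_nonneg (x := f e) (y := g e)
  by_cases h : δ < dist (f e) (g e)
  · rw [Set.indicator_of_mem (by exact h), div_le_iff₀ (by positivity)]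
    nlinarith
  · rw [Set.indicator_of_notMem (by exact h), div_le_iff₀ (by positivity)]
    nlinarith [mul_nonneg hδ h0]

end L0

namespace BranchingTree

variable {V : Type*} (T : BranchingTree V)

/-! ### Parents and ancestors -/

open Classical in
/-- The parent of a vertex; a vertex that is not a child of any vertex is its own parent. -/
noncomputable def parent (y : V) : V :=
  if h : ∃ x, y ∈ T.children x then h.choose else y

theorem parent_eq {x y : V} (h : y ∈ T.children x) : T.parent y = x := by
  have h' : ∃ x, y ∈ T.children x := ⟨x, h⟩
  rw [parent, dif_pos h']
  exact T.parent_unique h'.choose_spec h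

/-- The ancestor at level `k` of a vertex at level at least `k`. (A vertex at a level below `k`
is sent to itself.) -/
noncomputable def ancestor (k : ℕ) (x : V) : V := T.parent^[T.graph.dist T.root x - k] x

theorem ancestor_vertex (e : T.Boundary) {k n : ℕ} (h : k ≤ n) :
    T.ancestor k (e.vertex n) = e.vertex k := by
  rw [ancestor, dist_boundary]
  obtain ⟨d, rfl⟩ := Nat.exists_eq_add_of_le h
  rw [Nat.add_sub_cancel_left]
  induction d with
  | zero => rfl
  | succ d ih =>
    rw [Function.iterate_succ_apply, ← add_assoc, T.parent_eq (e.vertex_succ (k + d))]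
    exact ih (by omega)

theorem countable_vertices {V : Type*} (T : BranchingTree V) : Countable V := by
  have h : (Set.univ : Set V) = ⋃ n, {x | T.graph.dist T.root x = n} := by
    ext x; simp
  rw [← Set.countable_univ_iff, h]
  exact Set.countable_iUnion fun n => (T.finite_level n).countable

/-! ### Cylinder functions are dense in `L⁰` -/

/-- The cylinder sets: those determined by the vertex at one level. -/
def cylinders : Set (Set T.Boundary) := {s | ∃ (n : ℕ) (A : Set V), s = {e | e.vertex n ∈ A}}

theorem measurableSet_vertex_mem (n : ℕ) (A : Set V) :
    MeasurableSet {e : T.Boundary | e.vertex n ∈ A} := by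
  have : {e : T.Boundary | e.vertex n ∈ A} =
      ⋃ x ∈ {x | x ∈ T.level n ∧ x ∈ A}, T.sector x := by
    ext e
    simp only [Set.mem_iUnion, Set.mem_ofPred_eq, exists_prop]
    constructor
    · intro h
      exact ⟨e.vertex n, ⟨T.mem_level.2 (T.dist_boundary e n), h⟩, n, rfl⟩
    · rintro ⟨x, ⟨hx, hA⟩, h⟩
      rw [mem_sector_iff, T.mem_level.1 hx] at h
      rwa [h]
  rw [this]
  exact Set.Finite.measurableSet_biUnion ((T.level n).finite_toSet.subset fun x hx => hx.1)
    fun x _ => T.measurableSet_sector x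

theorem isSetAlgebra_cylinders : IsSetAlgebra T.cylinders where
  empty_mem := ⟨0, ∅, by simp⟩
  compl_mem := by
    rintro _ ⟨n, A, rfl⟩
    exact ⟨n, Aᶜ, rfl⟩
  union_mem := by
    rintro _ _ ⟨n, A, rfl⟩ ⟨m, B, rfl⟩
    refine ⟨max n m, {x | T.ancestor n x ∈ A ∨ T.ancestor m x ∈ B}, ?_⟩
    ext e
    simp [T.ancestor_vertex e (le_max_left n m), T.ancestor_vertex e (le_max_right n m)]

theorem measureDense_cylinders (Q : T.TransitionProb) : Q.prob.MeasureDense T.cylinders := by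
  refine Measure.MeasureDense.of_generateFrom_isSetAlgebra_finite _ T.isSetAlgebra_cylinders
    (le_antisymm ?_ ?_)
  · refine MeasurableSpace.generateFrom_le ?_
    rintro _ ⟨x, rfl⟩
    refine MeasurableSpace.measurableSet_generateFrom ⟨T.graph.dist T.root x, {x}, ?_⟩
    ext e
    exact T.mem_sector_iff e x
  · refine MeasurableSpace.generateFrom_le ?_
    rintro _ ⟨n, A, rfl⟩
    exact T.measurableSet_vertex_mem n A

variable {E : Type*} [NormedAddCommGroup E]

/-- Simple functions agree with functions of the vertex at one level, outside small sets. -/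
theorem exists_cylinder_simpleFunc (Q : T.TransitionProb) (s : SimpleFunc T.Boundary E) :
    ∀ δ : ℝ, 0 < δ → ∃ (k : ℕ) (g : V → E),
      Q.prob {e | s e ≠ g (e.vertex k)} ≤ ENNReal.ofReal δ := by
  classical
  induction s using SimpleFunc.induction with
  | const c hs =>
    intro δ hδ
    obtain ⟨_, ⟨k, A, rfl⟩, h⟩ :=
      (T.measureDense_cylinders Q).approx _ hs (measure_ne_top _ _) δ hδ
    refine ⟨k, A.indicator fun _ => c, (measure_mono ?_).trans h.le⟩
    intro e he
    by_contra hn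
    rw [Set.mem_symmDiff] at hn
    push Not at hn
    simp only [Set.mem_ofPred_eq] at hn he
    apply he
    by_cases h1 : e.vertex k ∈ A
    · simp [h1, hn.2 h1]
    · simp [h1, mt hn.1 h1]
  | add _ h₁ h₂ =>
    intro δ hδ
    obtain ⟨k₁, g₁, h₁⟩ := h₁ (δ / 2) (by positivity)
    obtain ⟨k₂, g₂, h₂⟩ := h₂ (δ / 2) (by positivity)
    refine ⟨max k₁ k₂, fun x => g₁ (T.ancestor k₁ x) + g₂ (T.ancestor k₂ x), ?_⟩
    rw [← add_halves δ, ENNReal.ofReal_add (by positivity) (by positivity)]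
    refine (measure_mono ?_).trans ((measure_union_le _ _).trans (add_le_add h₁ h₂))
    intro e he
    by_contra hn
    simp only [Set.mem_union, Set.mem_ofPred_eq, not_or, not_not] at hn
    apply he
    change _ = g₁ (T.ancestor k₁ _) + g₂ (T.ancestor k₂ _)
    rw [T.ancestor_vertex e (le_max_left k₁ k₂), T.ancestor_vertex e (le_max_right k₁ k₂),
      ← hn.1, ← hn.2]
    rfl

/-- `ω_k(g)` and `ω_l(h)` are close in `L⁰` if `g` and `h` mostly are along geodesics. -/
theorem dist_omega_le (Q : T.TransitionProb) (k l : ℕ) (g h : V → E) {δ : ℝ} (hδ : 0 ≤ δ) :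
    dist (T.omega Q k g) (T.omega Q l h) ≤
      δ + Q.prob.real {e | δ < dist (g (e.vertex k)) (h (e.vertex l))} :=
  L0.dist_mk_le (μ := Q.prob) (T.stronglyMeasurable_eval g k) (T.stronglyMeasurable_eval h l) hδ

/-- The functions `e ↦ g z`, with `z` the vertex of `e` at some level, are dense in `L⁰`, even if
`g` only ranges over a dense set of functions on the tree. -/
theorem exists_dist_omega_lt (Q : T.TransitionProb) {D : Set (V → E)} (hD : Dense D)
    (ψ : L0 Q.prob E) {ε : ℝ} (hε : 0 < ε) :
    ∃ k, ∃ g ∈ D, dist (T.omega Q k g) ψ < ε := by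
  obtain ⟨f, hf, rfl⟩ : ∃ (f : T.Boundary → E) (hf : StronglyMeasurable f),
      ψ = L0.mk Q.prob f hf :=
    ⟨_, AEEqFun.stronglyMeasurable ψ, (AEEqFun.mk_coeFn ψ).symm⟩
  -- The four errors of size `ε / 5`: a distance and a measure for the approximation of `f` by
  -- a simple function, a measure for that of the simple function by a cylinder function,
  -- and a distance for that of the cylinder function by one from `D`.
  have hη : 0 < ε / 5 := by positivity
  have hT := tendstoInMeasure_of_tendsto_ae (μ := Q.prob)
    (fun n => (hf.approx n).stronglyMeasurable.aestronglyMeasurable)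
    (Filter.Eventually.of_forall hf.tendsto_approx)
  rw [tendstoInMeasure_iff_dist] at hT
  obtain ⟨n, hn⟩ := ((hT (ε / 5) hη).eventually
    (ge_mem_nhds (ENNReal.ofReal_pos.2 hη))).exists
  obtain ⟨k, g, hg⟩ := T.exists_cylinder_simpleFunc Q (hf.approx n) (ε / 5) hη
  have hU : IsOpen {h : V → E | ∀ x ∈ T.level k, dist (h x) (g x) < ε / 5} := by
    have : {h : V → E | ∀ x ∈ T.level k, dist (h x) (g x) < ε / 5} =
        ⋂ x ∈ T.level k, {h : V → E | dist (h x) (g x) < ε / 5} := by ext; simp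
    rw [this]
    exact isOpen_biInter_finset fun x _ =>
      isOpen_lt ((continuous_apply x).dist continuous_const) continuous_const
  obtain ⟨h, hhg, hhD⟩ := hD.inter_open_nonempty _ hU ⟨g, fun x _ => by simpa using hη⟩
  refine ⟨k, h, hhD, ?_⟩
  have h1 : dist (T.omega Q k h) (T.omega Q k g) ≤ ε / 5 := by
    refine (T.dist_omega_le Q k k h g hη.le).trans ?_
    have : {e : T.Boundary | ε / 5 < dist (h (e.vertex k)) (g (e.vertex k))} = ∅ := by
      ext e
      simpa using (hhg _ (T.mem_level.2 (T.dist_boundary e k))).le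
    rw [this]
    simp
  have h2 : dist (T.omega Q k g) (L0.mk Q.prob f hf) ≤ ε / 5 + (ε / 5 + ε / 5) := by
    refine (L0.dist_mk_le (μ := Q.prob) (T.stronglyMeasurable_eval g k) hf hη.le).trans ?_
    gcongr
    refine ENNReal.toReal_le_of_le_ofReal (by positivity) ?_
    rw [ENNReal.ofReal_add hη.le hη.le]
    refine (measure_mono ?_).trans ((measure_union_le _ _).trans (add_le_add hn hg))
    intro e he
    by_contra hne
    simp only [Set.mem_union, Set.mem_ofPred_eq, not_or, not_not, not_le] at hne he
    rw [← hne.2] at he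
    exact lt_asymm he hne.1
  have h3 := dist_triangle (T.omega Q k h) (T.omega Q k g) (L0.mk Q.prob f hf)
  linarith

/-! ### Minor children -/

theorem exists_child_le_half (Q : T.TransitionProb) (x : V) :
    ∃ y ∈ T.children x, Q.q x y ≤ 1 / 2 := by
  classical
  by_contra! h
  obtain ⟨y, hy, z, hz, hne⟩ := T.nontrivial_children x
  have hy' : y ∈ T.children x := T.mem_children.2 hy
  have hz' : z ∈ T.children x := T.mem_children.2 hz
  have hsub : ({y, z} : Finset V) ⊆ T.children x := by
    intro u hu
    rcases Finset.mem_insert.1 hu with rfl | hu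
    · exact hy'
    · rwa [Finset.mem_singleton.1 hu]
  have h1 := Finset.sum_le_sum_of_subset_of_nonneg hsub
    fun u hu _ => (Q.pos x u hu).le
  rw [Q.sum_eq_one, Finset.sum_pair hne] at h1
  linarith [h y hy', h z hz']

/-- A child that is chosen with probability at most `1/2`. -/
noncomputable def minorChild (Q : T.TransitionProb) (x : V) : V :=
  (T.exists_child_le_half Q x).choose

theorem minorChild_mem (Q : T.TransitionProb) (x : V) : T.minorChild Q x ∈ T.children x :=
  (T.exists_child_le_half Q x).choose_spec.1

theorem q_minorChild_le (Q : T.TransitionProb) (x : V) : Q.q x (T.minorChild Q x) ≤ 1 / 2 :=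
  (T.exists_child_le_half Q x).choose_spec.2

theorem prob_sector_minorChild_le (Q : T.TransitionProb) (x : V) :
    Q.prob (T.sector (T.minorChild Q x)) ≤ 2⁻¹ * Q.prob (T.sector x) := by
  rcases (T.sector (T.minorChild Q x)).eq_empty_or_nonempty with h | ⟨e, he⟩
  · simp [h]
  have hmem := T.minorChild_mem Q x
  rw [mem_sector_iff, (T.mem_children.1 hmem).2] at he
  have hx : e.vertex (T.graph.dist T.root x) = x :=
    T.parent_unique (e.vertex_succ _) (he ▸ hmem)
  have h1 := T.prob_sector Q e (T.graph.dist T.root x + 1)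
  have h0 := T.prob_sector Q e (T.graph.dist T.root x)
  rw [Finset.prod_range_succ, ENNReal.ofReal_mul
    (Finset.prod_nonneg fun j _ => (Q.pos _ _ (e.vertex_succ j)).le), ← h0, he, hx] at h1
  rw [h1, mul_comm]
  gcongr
  refine (ENNReal.ofReal_le_ofReal (T.q_minorChild_le Q x)).trans_eq ?_
  rw [one_div, ENNReal.ofReal_inv_of_pos two_pos, ENNReal.ofReal_ofNat]

/-- Moving to the minor child halves the probability of any event known at level `n`. -/
theorem prob_minorChild_le (Q : T.TransitionProb) (n : ℕ) (A : Set V) :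
    Q.prob {e | e.vertex n ∈ A ∧ e.vertex (n + 1) = T.minorChild Q (e.vertex n)} ≤
      2⁻¹ * Q.prob {e | e.vertex n ∈ A} := by
  classical
  set S := (T.level n).filter (· ∈ A)
  have hS : ∀ x ∈ S, T.graph.dist T.root x = n := fun x hx =>
    T.mem_level.1 (Finset.mem_filter.1 hx).1
  have hvS : ∀ e : T.Boundary, e.vertex n ∈ A → e.vertex n ∈ S := fun e he =>
    Finset.mem_filter.2 ⟨T.mem_level.2 (T.dist_boundary e n), he⟩
  have hdisj : (S : Set V).PairwiseDisjoint T.sector := by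
    intro x hx y hy hxy
    refine Set.disjoint_left.2 fun e hex hey => hxy ?_
    rw [mem_sector_iff, hS x hx] at hex
    rw [mem_sector_iff, hS y hy] at hey
    rw [← hex, hey]
  calc Q.prob {e | e.vertex n ∈ A ∧ e.vertex (n + 1) = T.minorChild Q (e.vertex n)}
      ≤ Q.prob (⋃ x ∈ S, T.sector (T.minorChild Q x)) := by
        refine measure_mono fun e he => ?_
        exact Set.mem_biUnion (hvS e he.1) ⟨n + 1, he.2⟩
    _ ≤ ∑ x ∈ S, Q.prob (T.sector (T.minorChild Q x)) := measure_biUnion_finset_le _ _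
    _ ≤ ∑ x ∈ S, 2⁻¹ * Q.prob (T.sector x) :=
        Finset.sum_le_sum fun x _ => T.prob_sector_minorChild_le Q x
    _ = 2⁻¹ * Q.prob (⋃ x ∈ S, T.sector x) := by
        rw [← Finset.mul_sum, measure_biUnion_finset hdisj fun x _ => T.measurableSet_sector x]
    _ ≤ 2⁻¹ * Q.prob {e | e.vertex n ∈ A} := by
        gcongr
        refine Set.iUnion₂_subset fun x hx e he => ?_
        rw [mem_sector_iff, hS x hx] at he
        change e.vertex n ∈ A
        rw [he]
        exact (Finset.mem_filter.1 hx).2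


/-! ### Steering a harmonic function towards prescribed values -/

section Steering

variable {E : Type*} [NormedAddCommGroup E] [NormedSpace ℂ E]
variable (Q : T.TransitionProb) (w : V → V → ℂ) (n₀ : ℕ) (h : V → E) (a : ℕ → V → E)

open Classical in
/-- The values at level `n` of `steered`, by recursion on `n`; the values of this function at
vertices of other levels play no role. -/
noncomputable def steeredLevel : ℕ → V → E
  | 0 => h
  | n + 1 => fun y =>
    if n < n₀ then h y
    else a n.sqrt (T.parent y) +
      if y = T.minorChild Q (T.parent y) then
        (w (T.parent y) y)⁻¹ • (steeredLevel n (T.parent y) - a n.sqrt (T.parent y))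
      else 0

/-- The function that agrees with `h` up to level `n₀` and is then steered towards the targets `a`:
all children of a vertex `x` of level `n ≥ n₀` get the target value `a s x`, where `s = ⌊√n⌋`, except
for the minor child, whose value makes the function harmonic at `x`. Thus the target is `a s` for
the steps that lead from level `s ^ 2` to level `(s + 1) ^ 2`. -/
noncomputable def steered (x : V) : E := T.steeredLevel Q w n₀ h a (T.graph.dist T.root x) x

theorem steered_of_le {x : V} (hx : T.graph.dist T.root x ≤ n₀) :
    T.steered Q w n₀ h a x = h x := by
  rw [steered]
  rcases hd : T.graph.dist T.root x with _ | n
  · rfl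
  · exact if_pos (by omega)

open Classical in
theorem steered_child {x y : V} (hy : y ∈ T.children x) (hx : n₀ ≤ T.graph.dist T.root x) :
    T.steered Q w n₀ h a y = a (T.graph.dist T.root x).sqrt x +
      if y = T.minorChild Q x then
        (w x y)⁻¹ • (T.steered Q w n₀ h a x - a (T.graph.dist T.root x).sqrt x)
      else 0 := by
  rw [steered, (T.mem_children.1 hy).2]
  refine (if_neg (by omega)).trans ?_
  rw [T.parent_eq hy]
  rfl

theorem steered_mem_harmonic (hw_ne : ∀ x, ∀ y ∈ T.children x, w x y ≠ 0)
    (hw_sum : ∀ x, ∑ y ∈ T.children x, w x y = 1) (hh : h ∈ T.harmonic w E) :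
    T.steered Q w n₀ h a ∈ T.harmonic w E := by
  classical
  intro x
  rcases lt_or_ge (T.graph.dist T.root x) n₀ with hx | hx
  · rw [T.steered_of_le Q w n₀ h a hx.le, hh x]
    refine Finset.sum_congr rfl fun y hy => ?_
    rw [T.steered_of_le Q w n₀ h a (by rw [(T.mem_children.1 hy).2]; omega)]
  · rw [Finset.sum_congr rfl fun y hy => by rw [T.steered_child Q w n₀ h a hy hx]]
    have hm := T.minorChild_mem Q x
    simp only [smul_add, Finset.sum_add_distrib, ← Finset.sum_smul, hw_sum, one_smul, smul_ite,
      smul_zero, Finset.sum_ite_eq', hm, if_true]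
    rw [smul_inv_smul₀ (hw_ne x _ hm), add_sub_cancel]

theorem prob_steered_ne_succ_le {n : ℕ} (hn : n₀ ≤ n)
    (ha : ∀ e : T.Boundary, a n.sqrt (e.vertex (n + 1)) = a n.sqrt (e.vertex n)) :
    Q.prob {e | T.steered Q w n₀ h a (e.vertex (n + 1)) ≠ a n.sqrt (e.vertex (n + 1))} ≤
      2⁻¹ * Q.prob {e | T.steered Q w n₀ h a (e.vertex n) ≠ a n.sqrt (e.vertex n)} := by
  classical
  refine (measure_mono ?_).trans
    (T.prob_minorChild_le Q n {x | T.steered Q w n₀ h a x ≠ a n.sqrt x})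
  intro e he
  have key := T.steered_child Q w n₀ h a (e.vertex_succ n) (by rwa [dist_boundary])
  rw [dist_boundary] at key
  rw [Set.mem_ofPred_eq, ha, key] at he
  constructor
  · intro heq
    simp [heq] at he
  · by_contra hne
    simp [hne] at he

/-- During the steps from level `s ^ 2` to level `(s + 1) ^ 2` the target is missed only by
geodesics that always move to the minor child. -/
theorem prob_steered_ne_le {s : ℕ} (hs : n₀ ≤ s * s)
    (ha : ∀ n, s * s ≤ n → ∀ e : T.Boundary, a s (e.vertex (n + 1)) = a s (e.vertex n)) :
    Q.prob {e | T.steered Q w n₀ h a (e.vertex ((s + 1) * (s + 1))) ≠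
      a s (e.vertex ((s + 1) * (s + 1)))} ≤ 2⁻¹ ^ s := by
  have key : ∀ t ≤ s + s + 1, Q.prob {e | T.steered Q w n₀ h a (e.vertex (s * s + t)) ≠
      a s (e.vertex (s * s + t))} ≤ 2⁻¹ ^ t := by
    intro t
    induction t with
    | zero => intro _; simpa using prob_le_one
    | succ t ih =>
      intro ht
      have hsq : (s * s + t).sqrt = s := Nat.sqrt_add_eq s (by omega)
      have h1 := T.prob_steered_ne_succ_le Q w n₀ h a (n := s * s + t) (by omega)
        (by rw [hsq]; exact ha _ (by omega))
      rw [hsq] at h1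
      refine h1.trans ?_
      rw [pow_succ']
      gcongr
      exact ih (by omega)
  have h2 := key (s + s + 1) le_rfl
  rw [show s * s + (s + s + 1) = (s + 1) * (s + 1) by ring] at h2
  refine h2.trans (pow_le_pow_right_of_le_one' ?_ (by omega))
  exact ENNReal.inv_le_one.2 one_le_two

end Steering

/-! ### Families whose nontrivial linear combinations are universal -/

/-- A sequence that takes every value of a countable type infinitely often. -/
theorem exists_seq_frequently (α : Type*) [Countable α] [Nonempty α] :
    ∃ τ : ℕ → α, ∀ (x : α) (N : ℕ), ∃ s ≥ N, τ s = x := by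
  obtain ⟨σ, hσ⟩ := exists_surjective_nat α
  refine ⟨fun s => σ s.unpair.1, fun x N => ?_⟩
  obtain ⟨m, rfl⟩ := hσ x
  exact ⟨Nat.pair m N, Nat.right_le_pair m N, by simp⟩

section Family

variable {E : Type*} [NormedAddCommGroup E] [NormedSpace ℂ E]

/-- A linear combination of harmonic functions is universal if infinitely often, for some fixed
`j` with nonzero coefficient and any given cylinder function from a dense set, the `j`-th function
is close to the cylinder function and all others are close to zero. -/
theorem linearCombination_mem_universal (Q : T.TransitionProb) {w : V → V → ℂ} {J : Type*}
    (f : J → T.harmonic w E) (c : J →₀ ℂ) {j : J} (hj : c j ≠ 0) {D : Set (V → E)} (hD : Dense D)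
    (H : ∀ g ∈ D, ∀ k N : ℕ, ∃ s ≥ N, ∃ n ≥ 1, ∃ t : J → T.Boundary → E,
      (∀ e, t j e = g (e.vertex k)) ∧ (∀ i ≠ j, ∀ e, t i e = 0) ∧
      ∀ i ∈ c.support, Q.prob {e | (f i).1 (e.vertex n) ≠ t i e} ≤ 2⁻¹ ^ s) :
    Finsupp.linearCombination ℂ f c ∈ T.universal Q w E := by
  refine Metric.dense_iff.2 fun ψ ε hε => ?_
  have hD' : Dense ((fun g : V → E => c j • g) '' D) :=
    (Homeomorph.smulOfNeZero (c j) hj).surjective.denseRange.dense_image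
      (Homeomorph.smulOfNeZero (c j) hj).continuous hD
  obtain ⟨k, _, ⟨g, hg, rfl⟩, hk⟩ := T.exists_dist_omega_lt Q hD' ψ (half_pos hε)
  obtain ⟨N, hN⟩ : ∃ N : ℕ, ∀ s ≥ N, c.support.card * (2⁻¹ : ℝ) ^ s < ε / 2 := by
    have ht : Filter.Tendsto (fun s : ℕ => c.support.card * (2⁻¹ : ℝ) ^ s) Filter.atTop
        (nhds (c.support.card * 0)) :=
      (tendsto_pow_atTop_nhds_zero_of_lt_one (by norm_num) (by norm_num)).const_mul _
    rw [mul_zero] at ht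
    exact Filter.eventually_atTop.1 (ht.eventually (gt_mem_nhds (half_pos hε)))
  obtain ⟨s, hs, n, hn, t, htj, hti, hprob⟩ := H g hg k N
  refine ⟨T.omega Q n (Finsupp.linearCombination ℂ f c).1, ?_, n, hn, rfl⟩
  have hd : dist (T.omega Q n (Finsupp.linearCombination ℂ f c).1) (T.omega Q k (c j • g)) ≤
      c.support.card * (2⁻¹ : ℝ) ^ s := by
    refine (T.dist_omega_le Q n k _ _ le_rfl).trans ?_
    rw [zero_add]
    refine ENNReal.toReal_le_of_le_ofReal (by positivity) ?_
    calc Q.prob {e | 0 < dist ((Finsupp.linearCombination ℂ f c).1 (e.vertex n))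
            ((c j • g) (e.vertex k))}
        ≤ Q.prob (⋃ i ∈ c.support, {e | (f i).1 (e.vertex n) ≠ t i e}) := by
          refine measure_mono fun e he => ?_
          by_contra hne
          simp only [Set.mem_iUnion, Set.mem_ofPred_eq, not_exists, not_not] at hne
          refine (dist_pos.1 he) ?_
          rw [Finsupp.linearCombination_apply, Finsupp.sum]
          have hsum : (∑ i ∈ c.support, c i • f i : T.harmonic w E).1 (e.vertex n) =
              ∑ i ∈ c.support, c i • (f i).1 (e.vertex n) := by
            simp
          rw [hsum, Finset.sum_eq_single_of_mem j (Finsupp.mem_support_iff.2 hj), hne j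
            (Finsupp.mem_support_iff.2 hj), htj]
          · rfl
          · intro i hi hij
            rw [hne i hi, hti i hij, smul_zero]
      _ ≤ ∑ i ∈ c.support, Q.prob {e | (f i).1 (e.vertex n) ≠ t i e} :=
          measure_biUnion_finset_le _ _
      _ ≤ ∑ _i ∈ c.support, 2⁻¹ ^ s := Finset.sum_le_sum hprob
      _ = ENNReal.ofReal (c.support.card * (2⁻¹ : ℝ) ^ s) := by
          rw [Finset.sum_const, nsmul_eq_mul, ENNReal.ofReal_mul (by positivity),
            ENNReal.ofReal_natCast, ENNReal.ofReal_pow (by positivity),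
            ENNReal.ofReal_inv_of_pos two_pos, ENNReal.ofReal_ofNat]
  rw [Metric.mem_ball]
  have := hN s hs
  have := dist_triangle (T.omega Q n (Finsupp.linearCombination ℂ f c).1)
    (T.omega Q k (c j • g)) ψ
  linarith

/-- Any countable family of harmonic functions can be modified above prescribed levels to one all
of whose nontrivial linear combinations are universal. -/
theorem exists_family_universal [TopologicalSpace.SeparableSpace E] (Q : T.TransitionProb)
    {w : V → V → ℂ} (hw_ne : ∀ x, ∀ y ∈ T.children x, w x y ≠ 0)
    (hw_sum : ∀ x, ∑ y ∈ T.children x, w x y = 1) {J : Type*} [Countable J] [Nonempty J]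
    (h : J → T.harmonic w E) (n₀ : J → ℕ) :
    ∃ f : J → T.harmonic w E,
      (∀ j x, T.graph.dist T.root x ≤ n₀ j → (f j).1 x = (h j).1 x) ∧
      ∀ c : J →₀ ℂ, c ≠ 0 → Finsupp.linearCombination ℂ f c ∈ T.universal Q w E := by
  classical
  have := T.countable_vertices
  have : SecondCountableTopology E := UniformSpace.secondCountable_of_separable E
  let d : ℕ → V → E := TopologicalSpace.denseSeq (V → E)
  obtain ⟨τ, hτ⟩ := exists_seq_frequently (J × ℕ × ℕ)
  -- In block `s`, with `τ s = (i, k, l)`, the `i`-th function is steered towards the value of `d l`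
  -- at the ancestor of level `k`, and all others are steered towards zero.
  let a : J → ℕ → V → E := fun j s x =>
    if (τ s).1 = j then d (τ s).2.2 (T.ancestor (τ s).2.1 x) else 0
  refine ⟨fun j => ⟨T.steered Q w (n₀ j) (h j).1 (a j),
    T.steered_mem_harmonic Q w (n₀ j) _ _ hw_ne hw_sum (h j).2⟩,
    fun j x hx => T.steered_of_le Q w (n₀ j) _ _ hx, fun c hc => ?_⟩
  obtain ⟨j, hj⟩ := Finsupp.ne_iff.1 hc
  refine T.linearCombination_mem_universal Q _ c hj (TopologicalSpace.denseRange_denseSeq (V → E)) ?_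
  rintro _ ⟨l, rfl⟩ k N
  obtain ⟨s, hs, hτs⟩ := hτ (j, k, l) (max N (max k (c.support.sup n₀)))
  have hks : k ≤ s := ((le_max_left _ _).trans (le_max_right _ _)).trans hs
  have hss : s ≤ s * s := Nat.le_mul_self s
  refine ⟨s, (le_max_left _ _).trans hs, (s + 1) * (s + 1), Nat.le_mul_self (s + 1) |>.trans' (by omega),
    fun i e => a i s (e.vertex ((s + 1) * (s + 1))), fun e => ?_, fun i hi e => ?_, fun i hi => ?_⟩
  · simp only [a, hτs, if_true]
    rw [T.ancestor_vertex e (by nlinarith)]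
  · simp only [a, hτs, if_neg hi.symm]
  · have hni : n₀ i ≤ s :=
      (Finset.le_sup hi).trans (((le_max_right _ _).trans (le_max_right _ _)).trans hs)
    refine T.prob_steered_ne_le Q w (n₀ i) _ _ (hni.trans hss) fun n hn e => ?_
    simp only [a, hτs]
    rw [T.ancestor_vertex e (by omega), T.ancestor_vertex e (by omega)]

theorem not_zero_mem_universal [Nontrivial E] (Q : T.TransitionProb) (w : V → V → ℂ) :
    (0 : T.harmonic w E) ∉ T.universal Q w E := by
  intro h0
  obtain ⟨v, hv⟩ := exists_ne (0 : E)
  -- A constant `v ≠ 0` has a positive distance to every `ω_n(0)`.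
  obtain ⟨_, hmem, n, -, rfl⟩ := Metric.dense_iff.1 h0 (T.omega Q 0 fun _ => v)
    (‖v‖ / (1 + ‖v‖)) (div_pos (norm_pos_iff.2 hv) (by positivity))
  rw [Metric.mem_ball] at hmem
  refine hmem.ne ?_
  have hz : ∀ᵐ e ∂Q.prob, T.omega Q n (0 : T.harmonic w E).1 e = 0 :=
    L0.coeFn_mk _ (T.stronglyMeasurable_eval _ n)
  have hc : ∀ᵐ e ∂Q.prob, T.omega Q 0 (fun _ => v) e = v :=
    L0.coeFn_mk _ (T.stronglyMeasurable_eval (fun _ : V => v) 0)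
  change ∫ e, _ ∂Q.prob = _
  rw [integral_congr_ae (g := fun _ => ‖v‖ / (1 + ‖v‖))]
  · simp
  · filter_upwards [hz, hc] with e h1 h2
    rw [h1, h2, dist_zero_left]

end Family

end BranchingTree

/-! ### The two subspaces -/

/-- Double algebraic genericity of the universal harmonic functions on a tree. -/
theorem mainTheorem1 {V : Type*} (T : BranchingTree V) (Q : T.TransitionProb)
    (w : V → V → ℂ) (hw_ne : ∀ x, ∀ y ∈ T.children x, w x y ≠ 0)
    (hw_sum : ∀ x, ∑ y ∈ T.children x, w x y = 1)
    (E : Type*) [NormedAddCommGroup E] [NormedSpace ℂ E] [TopologicalSpace.SeparableSpace E] :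
    ∃ F₁ F₂ : Submodule ℂ (T.harmonic w E),
      (F₁ : Set (T.harmonic w E)) ⊆ T.universal Q w E ∪ {0} ∧
      (F₂ : Set (T.harmonic w E)) ⊆ T.universal Q w E ∪ {0} ∧
      Dense (F₁ : Set (T.harmonic w E)) ∧
      Dense (F₂ : Set (T.harmonic w E)) ∧
      F₁ ⊓ F₂ = ⊥ := by
  have := T.countable_vertices
  have : SecondCountableTopology E := UniformSpace.secondCountable_of_separable E
  have : SecondCountableTopology (T.harmonic w E) :=
    TopologicalSpace.Subtype.secondCountableTopology (T.harmonic w E : Set (V → E))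
  let u : ℕ → T.harmonic w E := TopologicalSpace.denseSeq (T.harmonic w E)
  -- `f (b, i, n)` agrees with `u i` up to level `n`; the two values of `b` give the two subspaces.
  obtain ⟨f, hfu, hf⟩ := T.exists_family_universal Q hw_ne hw_sum (J := Bool × ℕ × ℕ)
    (fun j => u j.2.1) (fun j => j.2.2)
  have hsub : ∀ S : Set (Bool × ℕ × ℕ), (Submodule.span ℂ (f '' S) : Set (T.harmonic w E)) ⊆
      T.universal Q w E ∪ {0} := by
    intro S x hx
    obtain ⟨c, -, rfl⟩ := (Finsupp.mem_span_image_iff_linearCombination ℂ).1 hx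
    by_cases hc : c = 0
    · right; simp [hc]
    · exact Or.inl (hf c hc)
  have hdense : ∀ b : Bool,
      Dense (Submodule.span ℂ (f '' {j | j.1 = b}) : Set (T.harmonic w E)) := by
    intro b
    refine Dense.of_closure (((TopologicalSpace.denseRange_denseSeq (T.harmonic w E)).mono ?_))
    rintro _ ⟨i, rfl⟩
    refine mem_closure_of_tendsto (f := fun n : ℕ => f (b, i, n)) (b := Filter.atTop) ?_
      (Filter.Eventually.of_forall fun n => Submodule.subset_span ⟨_, rfl, rfl⟩)
    rw [tendsto_subtype_rng, tendsto_pi_nhds]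
    intro x
    refine tendsto_const_nhds.congr' ?_
    filter_upwards [Filter.eventually_ge_atTop (T.graph.dist T.root x)] with n hn
    exact (hfu (b, i, n) x hn).symm
  refine ⟨_, _, hsub {j | j.1 = true}, hsub {j | j.1 = false}, hdense true, hdense false, ?_⟩
  rcases subsingleton_or_nontrivial E with hE | hE
  · exact Subsingleton.elim _ _
  · -- As `0` is not universal, the family `f` is linearly independent.
    have hli : LinearIndependent ℂ f := by
      rw [linearIndependent_iff]
      intro c hc
      by_contra hne
      exact T.not_zero_mem_universal Q w (hc ▸ hf c hne)
    refine (hli.disjoint_span_image ?_).eq_bot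
    exact Set.disjoint_left.2 fun j h1 h2 => Bool.noConfusion (h1.symm.trans h2)
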